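/- **Theorem (Soundness for exceptions).** *Language.* Fix a set $\mathrm{Exc}$ of exception names with decidable equality. Expressions, values and evaluation contexts are given by $$e ::= v \mid x \mid e_1\,e_2 \mid \mathtt{try}\ e_1\ \mathtt{catch}^{c}\ h\ \mathtt{with}\ e_2 \mid \mathtt{throw}\ c\ e,\qquad v ::= \mathtt{rec}\ f\,x = e,$$ $$K ::= \square \mid K[\square\, v] \mid K[e\,\square] \mid K[\mathtt{try}\ \square\ \mathtt{catch}^{c}\ h\ \mathtt{with}\ e] \mid K[\mathtt{throw}\ c\ \square]$$ ($c\in\mathrm{Exc}$; $f,x$ are bound in the body of $\mathtt{rec}$, and $h$ is bound in the handler $e_2$; substitution is capture-avoiding; terms may be open). Configurations are $\langle e\rangle_{\rm term}$, $\langle e,K\rangle_{\rm eval}$, $\langle K,v\rangle_{\rm cont}$, $\langle v\rangle_{\rm ret}$. The transitions $\mapsto$ of the abstract machine are exactly: - $\langle e\rangle_{\rm term}\mapsto\langle e,\square\rangle_{\rm eval}$ and $\langle\square,v\rangle_{\rm cont}\mapsto\langle v\rangle_{\rm ret}$; - $\langle e_0\,e_1,K\rangle_{\rm eval}\mapsto\langle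 e_1,K[e_0\,\square]\rangle_{\rm eval}$ and $\langle v,K\rangle_{\rm eval}\mapsto\langle K,v\rangle_{\rm cont}$; - $\langle K[e\,\square],v\rangle_{\rm cont}\mapsto\langle e,K[\square\,v]\rangle_{\rm eval}$ and $\langle K[\square\,w],v\rangle_{\rm cont}\mapsto\langle w,K[v\,\square]\rangle_{\rm eval}$ ($w$ a value); - $\langle K[(\mathtt{rec}\,f\,x=e)\,\square],v\rangle_{\rm cont}\mapsto\langle e[v/x,\ (\mathtt{rec}\,f\,x=e)/f],K\rangle_{\rm eval}$; - $\langle\mathtt{try}\ e_1\ \mathtt{catch}^c\ h\ \mathtt{with}\ e_2,K\rangle_{\rm eval}\mapsto\langle e_1,K[\mathtt{try}\ \square\ \mathtt{catch}^c\ h\ \mathtt{with}\ e_2]\rangle_{\rm eval}$; - $\langle\mathtt{throw}\ c\ e,K\rangle_{\rm eval}\mapsto\langle e,K[\mathtt{throw}\ c\ \square]\rangle_{\rm eval}$; - $\langle K[\mathtt{try}\ \square\ \mathtt{catch}^c\ h\ \mathtt{with}\ e],v\rangle_{\rm cont}\mapsto\langle v,K\rangle_{\rm eval}$; - $\langle K'[\mathtt{try}\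 K[\mathtt{throw}\ c\ \square]\ \mathtt{catch}^c\ h\ \mathtt{with}\ e],v\rangle_{\rm cont}\mapsto\langle e[v/h],K'\rangle_{\rm eval}$, provided that $K$ contains no handler for $c$. *Guarded interaction trees.* Work in the model of guarded type theory by complete ordered families of equivalences (with separated families, so that internal equality at all times is equality, and with nonexpansive maps as functions), with later modality $\blacktriangleright$, $\mathrm{Next}:X\to\blacktriangleright X$ and guarded fixed points $\mathrm{fix}:(\blacktriangleright X\to X)\to X$. Let $A$ be a ground type with an element $()$ and let $\mathrm{Error}$ be a set with an element $\mathrm{RunTime}$. Let $\mathrm{IT}$ be the guarded recursive type with constructors $\mathrm{Ret}:A\to\mathrm{IT}$, $\mathrm{Fun}:\blacktriangleright(\mathrm{IT}\to\mathrm{IT})\to\mathrm{IT}$, $\mathrm{Err}:\mathrm{Error}\to\mathrm{IT}$, $\mathrm{Tau}:\blacktriangleright\mathrm{IT}\to\mathrm{IT}$ and $\mathrm{Vis}_i:\mathrm{Ins}_i(\mathrm{IT})\times(\mathrm{Outs}_i(\mathrm{IT})\to\blacktriangleright\mathrm{IT})\to\mathrm{IT}$ for $i\in\{\mathtt{throw},\mathtt{register},\mathtt{pop}\}$,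 where $$\mathrm{Ins}_{\mathtt{throw}}(X)=\mathrm{Exc}\times\blacktriangleright X,\quad \mathrm{Ins}_{\mathtt{register}}(X)=\mathrm{Exc}\times(\blacktriangleright X\to\blacktriangleright X)\times\blacktriangleright X,\quad \mathrm{Ins}_{\mathtt{pop}}(X)=\mathrm{Exc},$$ $$\mathrm{Outs}_{\mathtt{throw}}(X)=0,\quad \mathrm{Outs}_{\mathtt{register}}(X)=\blacktriangleright X,\quad \mathrm{Outs}_{\mathtt{pop}}(X)=1.$$ Put $\mathrm{Tick}=\mathrm{Tau}\circ\mathrm{Next}$. The map $\mathrm{getval}(-,f)$ commutes with $\mathrm{Err}$, $\mathrm{Tau}$ and $\mathrm{Vis}_i$ (is applied under $\blacktriangleright$ in the arguments) and sends the values $\mathrm{Ret}(a)$, $\mathrm{Fun}(g)$ to $f$ of them; $\mathrm{getfun}(-,f)$ is defined likewise, with $\mathrm{Fun}(g)\mapsto f(g)$ and $\mathrm{Ret}(a)\mapsto\mathrm{Err}(\mathrm{RunTime})$. Call-by-value application is $\alpha\odot\beta=\mathrm{getval}\big(\beta,\lambda v.\,\mathrm{getfun}(\alpha,\lambda g.\,\mathrm{Tau}(\blacktriangleright(\lambda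 g'.\,g'\,v)\,g))\big)$. *Reification and reduction.* A state is a list of triples $(c,h,\kappa)$ with $c\in\mathrm{Exc}$ and $h,\kappa:\blacktriangleright\mathrm{IT}\to\blacktriangleright\mathrm{IT}$ (handler and saved continuation), innermost handler first. The reifiers are $r_{\mathtt{register}}((c,h,x),\sigma,\kappa)=\mathrm{Some}(x,(c,h,\kappa)::\sigma)$; $r_{\mathtt{throw}}((c,x),\sigma,\kappa)=\mathrm{Some}(\kappa'(h\,x),\sigma_2)$ if $\sigma=\sigma_1{+\!\!+}[(c,h,\kappa')]{+\!\!+}\sigma_2$ with no entry for $c$ in $\sigma_1$, and $\mathrm{None}$ if $\sigma$ has no entry for $c$; $r_{\mathtt{pop}}(c,\sigma,\kappa)=\mathrm{Some}(\kappa'(\kappa\,()),\sigma')$ if $\sigma=(c,h,\kappa')::\sigma'$, and $\mathrm{None}$ otherwise. Let $\mathrm{reify}(\mathrm{Vis}_i(x,\kappa),\sigma)$ be $(\mathrm{Tau}(\beta),\sigma')$ if $r_i(x,\sigma,\kappa)=\mathrm{Some}(\beta,\sigma')$ and $(\mathrm{Err}(\mathrm{RunTime}),\sigma)$ if $r_i(x,\sigma,\kappa)=\mathrm{None}$.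 Let $(\alpha,\sigma)\rightsquigarrow(\beta,\sigma')$ hold iff either $\alpha=\mathrm{Tick}(\beta)$ and $\sigma=\sigma'$, or $\alpha=\mathrm{Vis}_i(x,\kappa)$ for some $i,x,\kappa$ and $\mathrm{reify}(\alpha,\sigma)=(\mathrm{Tick}(\beta),\sigma')$; let $\rightsquigarrow^*$ be its reflexive transitive closure. *Denotations.* Put $\mathrm{POP}(c)=\mathrm{Vis}_{\mathtt{pop}}(c,\lambda\_.\,\mathrm{Next}(\mathrm{Ret}()))$, $\mathrm{REG}(c,h,x)=\mathrm{Vis}_{\mathtt{register}}((c,h,x),\mathrm{id})$, $\mathrm{THROW}(c,x)=\mathrm{getval}(x,\lambda r.\,\mathrm{Vis}_{\mathtt{throw}}((c,\mathrm{Next}\,r),\bot\text{-}\mathrm{elim}))$, $P_c(x)=\mathrm{getval}(x,\lambda r.\,\mathrm{getval}(\mathrm{POP}(c),\lambda\_.\,r))$ and $\mathrm{CATCH}(c,h,x)=\mathrm{REG}(c,h,\mathrm{Next}(P_c(x)))$. For $\rho:\mathrm{Var}\to\mathrm{IT}$ let $$[\![x]\!]_\rho=\rho(x),\qquad [\![e_1\,e_2]\!]_\rho=[\![e_1]\!]_\rho\odot[\![e_2]\!]_\rho,\qquad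 [\![\mathtt{throw}\ c\ e]\!]_\rho=\mathrm{THROW}(c,[\![e]\!]_\rho),$$ $$[\![\mathtt{rec}\,f\,x=e]\!]_\rho=\mathrm{fix}\big(\lambda t.\,\mathrm{Fun}(\blacktriangleright(\lambda\varphi.\,\lambda\alpha.\,[\![e]\!]_{\rho[f\mapsto\varphi,x\mapsto\alpha]})\,t)\big),$$ $$[\![\mathtt{try}\ e_1\ \mathtt{catch}^c\ h\ \mathtt{with}\ e_2]\!]_\rho=\mathrm{CATCH}(c,\blacktriangleright(\lambda\alpha.\,[\![e_2]\!]_{\rho[h\mapsto\alpha]}),[\![e_1]\!]_\rho).$$ A context $K$ denotes a pair of a map $\mathrm{IT}\to\mathrm{IT}$ and a state: $[\![\square]\!]_\rho=(\mathrm{id},[])$ and, with $(\kappa,\sigma)=[\![K]\!]_\rho$, $$[\![K[\square\,v]]\!]_\rho=(\kappa\circ(\lambda y.\,y\odot[\![v]\!]_\rho),\sigma),\quad [\![K[e\,\square]]\!]_\rho=(\kappa\circ(\lambda y.\,[\![e]\!]_\rho\odot y),\sigma),\quad [\![K[\mathtt{throw}\ c\ \square]]\!]_\rho=(\kappa\circ\mathrm{THROW}(c,-),\sigma),$$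 $$[\![K[\mathtt{try}\ \square\ \mathtt{catch}^c\ h\ \mathtt{with}\ e]]\!]_\rho=\big(P_c,\ (c,\blacktriangleright(\lambda\alpha.\,[\![e]\!]_{\rho[h\mapsto\alpha]}),\blacktriangleright\kappa)::\sigma\big).$$ Configurations denote pairs of a tree and a state: with $(\kappa,\sigma)=[\![K]\!]_\rho$, $[\![\langle e,K\rangle_{\rm eval}]\!]_\rho=(\kappa([\![e]\!]_\rho),\sigma)$, $[\![\langle K,v\rangle_{\rm cont}]\!]_\rho=(\kappa([\![v]\!]_\rho),\sigma)$, $[\![\langle e\rangle_{\rm term}]\!]_\rho=([\![e]\!]_\rho,[])$, $[\![\langle v\rangle_{\rm ret}]\!]_\rho=([\![v]\!]_\rho,[])$. *Claim.* For all configurations $c_0,c_1$ with $c_0\mapsto c_1$ and all environments $\rho$, $$[\![c_0]\!]_\rho\rightsquigarrow^*[\![c_1]\!]_\rho.$$ -/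

import Mathlib

universe u

namespace GITree

/-! ## Step-indexed types

The types of the guarded type theory are modelled, as in Iris, by complete ordered families of
equivalences; terms of function type are nonexpansive maps.  Families are separated, so that the
internal equality at all times is equality. -/

/-- A complete ordered family of equivalences: `dist n x y` says that `x` and `y` are equal
at time `n`. -/
structure Cofe : Type (u + 1) where
  Carrier : Type u
  dist : ℕ → Carrier → Carrier → Prop
  dist_equiv : ∀ n, Equivalence (dist n)
  dist_mono : ∀ {m n x y}, m ≤ n → dist n x y → dist m x y
  eq_of_dist : ∀ {x y}, (∀ n, dist n x y) → x = y
  complete : ∀ c : ℕ → Carrier, (∀ n, dist n (c n) (c (n + 1))) → ∃ x, ∀ n, dist n x (c n)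

namespace Cofe

instance : CoeSort Cofe.{u} (Type u) := ⟨Cofe.Carrier⟩

theorem refl (X : Cofe.{u}) (n : ℕ) (x : X) : X.dist n x x := (X.dist_equiv n).refl x

theorem symm (X : Cofe.{u}) {n : ℕ} {x y : X} (h : X.dist n x y) : X.dist n y x :=
  (X.dist_equiv n).symm h

theorem trans (X : Cofe.{u}) {n : ℕ} {x y z : X} (h : X.dist n x y) (h' : X.dist n y z) :
    X.dist n x z := (X.dist_equiv n).trans h h'

theorem of_eq (X : Cofe.{u}) {n : ℕ} {x y : X} (h : x = y) : X.dist n x y := h ▸ X.refl n x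

theorem chain_dist (X : Cofe.{u}) {c : ℕ → X} (hc : ∀ n, X.dist n (c n) (c (n + 1)))
    {m n : ℕ} (h : m ≤ n) : X.dist m (c m) (c n) := by
  induction n, h using Nat.le_induction with
  | base => exact X.refl _ _
  | succ n hmn ih => exact X.trans ih (X.dist_mono hmn (hc n))

/-- Nonexpansive maps. -/
@[ext] structure Hom (X Y : Cofe.{u}) : Type u where
  toFun : X → Y
  ne : ∀ {n x y}, X.dist n x y → Y.dist n (toFun x) (toFun y)

instance (X Y : Cofe.{u}) : CoeFun (Hom X Y) (fun _ => X → Y) := ⟨Hom.toFun⟩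

namespace Hom

/-- The identity map. -/
def id (X : Cofe.{u}) : Hom X X := ⟨fun x => x, fun h => h⟩

/-- Composition `g ∘ f`. -/
def comp {X Y Z : Cofe.{u}} (g : Hom Y Z) (f : Hom X Y) : Hom X Z :=
  ⟨fun x => g (f x), fun h => g.ne (f.ne h)⟩

/-- Constant maps. -/
def const (X : Cofe.{u}) {Y : Cofe.{u}} (y : Y) : Hom X Y := ⟨fun _ => y, fun _ => Y.refl _ _⟩

end Hom

/-- The type of nonexpansive maps `X → Y`. -/
def fn (X Y : Cofe.{u}) : Cofe.{u} where
  Carrier := Hom X Y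
  dist n f g := ∀ x, Y.dist n (f x) (g x)
  dist_equiv n := ⟨fun f x => Y.refl n (f x), fun h x => Y.symm (h x),
    fun h h' x => Y.trans (h x) (h' x)⟩
  dist_mono h hf x := Y.dist_mono h (hf x)
  eq_of_dist h := Hom.ext (funext fun x => Y.eq_of_dist fun n => h n x)
  complete c hc := by
    choose l hl using fun x => Y.complete (fun n => c n x) (fun n => hc n x)
    exact ⟨⟨l, fun {n x y} h => Y.trans (hl x n) (Y.trans ((c n).ne h) (Y.symm (hl y n)))⟩,
      fun n x => hl x n⟩

/-- A set, as a type on which time plays no role. -/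
def discrete (A : Type u) : Cofe.{u} where
  Carrier := A
  dist _ x y := x = y
  dist_equiv _ := ⟨fun _ => rfl, Eq.symm, Eq.trans⟩
  dist_mono _ h := h
  eq_of_dist h := h 0
  complete c hc := ⟨c 0, fun n => by
    induction n with
    | zero => rfl
    | succ n ih => exact ih.trans (hc n)⟩

/-- Binary products. -/
def prod (X Y : Cofe.{u}) : Cofe.{u} where
  Carrier := X × Y
  dist n a b := X.dist n a.1 b.1 ∧ Y.dist n a.2 b.2
  dist_equiv n := ⟨fun a => ⟨X.refl n a.1, Y.refl n a.2⟩, fun h => ⟨X.symm h.1, Y.symm h.2⟩,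
    fun h h' => ⟨X.trans h.1 h'.1, Y.trans h.2 h'.2⟩⟩
  dist_mono h hab := ⟨X.dist_mono h hab.1, Y.dist_mono h hab.2⟩
  eq_of_dist h := Prod.ext (X.eq_of_dist fun n => (h n).1) (Y.eq_of_dist fun n => (h n).2)
  complete c hc := by
    obtain ⟨x, hx⟩ := X.complete (fun n => (c n).1) (fun n => (hc n).1)
    obtain ⟨y, hy⟩ := Y.complete (fun n => (c n).2) (fun n => (hc n).2)
    exact ⟨(x, y), fun n => ⟨hx n, hy n⟩⟩

/-- Powers: families of elements of `X` indexed by a set. -/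
def power (I : Type) (X : Cofe.{u}) : Cofe.{u} where
  Carrier := I → X
  dist n a b := ∀ i, X.dist n (a i) (b i)
  dist_equiv n := ⟨fun a i => X.refl n (a i), fun h i => X.symm (h i),
    fun h h' i => X.trans (h i) (h' i)⟩
  dist_mono h hab i := X.dist_mono h (hab i)
  eq_of_dist h := funext fun i => X.eq_of_dist fun n => h n i
  complete c hc := by
    choose l hl using fun i => X.complete (fun n => c n i) (fun n => hc n i)
    exact ⟨l, fun n i => hl i n⟩

/-- Disjoint unions indexed by a set. -/
def sigma (I : Type u) (Y : I → Cofe.{u}) : Cofe.{u} where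
  Carrier := Σ i, Y i
  dist n a b := ∃ h : a.1 = b.1, (Y b.1).dist n (h ▸ a.2) b.2
  dist_equiv n := by
    refine ⟨fun a => ⟨rfl, (Y a.1).refl n a.2⟩, ?_, ?_⟩
    · rintro ⟨i, x⟩ ⟨j, y⟩ ⟨h, hxy⟩
      cases h
      exact ⟨rfl, (Y i).symm hxy⟩
    · rintro ⟨i, x⟩ ⟨j, y⟩ ⟨k, z⟩ ⟨h, hxy⟩ ⟨h', hyz⟩
      cases h
      cases h'
      exact ⟨rfl, (Y i).trans hxy hyz⟩
  dist_mono h := by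
    rintro ⟨e, hxy⟩
    exact ⟨e, (Y _).dist_mono h hxy⟩
  eq_of_dist := by
    rintro ⟨i, x⟩ ⟨j, y⟩ h
    obtain ⟨e, -⟩ := h 0
    cases e
    have : x = y := (Y i).eq_of_dist fun n => (h n).2
    rw [this]
  complete c hc := by
    have h : ∀ n, ∃ y : Y (c 0).1, c n = ⟨(c 0).1, y⟩ := by
      intro n
      induction n with
      | zero => exact ⟨(c 0).2, rfl⟩
      | succ n ih =>
        obtain ⟨y, hy⟩ := ih
        obtain ⟨e, -⟩ := hc n
        rw [hy] at e
        generalize c (n + 1) = z at e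
        obtain ⟨j, z⟩ := z
        dsimp only at e
        subst e
        exact ⟨z, rfl⟩
    choose d hd using h
    have hdc : ∀ n, (Y (c 0).1).dist n (d n) (d (n + 1)) := by
      intro n
      have := hc n
      rw [hd n, hd (n + 1)] at this
      exact this.2
    obtain ⟨y, hy⟩ := (Y (c 0).1).complete d hdc
    refine ⟨⟨(c 0).1, y⟩, fun n => ?_⟩
    rw [hd n]
    exact ⟨rfl, hy n⟩

/-- Elements that are available one step later. -/
@[ext] structure Later (α : Type u) : Type u where
  next ::
  force : α

/-- The type `▶ X`: equality of `Next x` and `Next y` at time `n` is equality of `x` and `y` at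
all earlier times. -/
def later (X : Cofe.{u}) : Cofe.{u} where
  Carrier := Later X
  dist n x y := ∀ m < n, X.dist m x.force y.force
  dist_equiv n := ⟨fun x m _ => X.refl m x.force, fun h m hm => X.symm (h m hm),
    fun h h' m hm => X.trans (h m hm) (h' m hm)⟩
  dist_mono h hxy m hm := hxy m (lt_of_lt_of_le hm h)
  eq_of_dist h := Later.ext (X.eq_of_dist fun n => h (n + 1) n n.lt_succ_self)
  complete c hc := by
    have hc' : ∀ n, X.dist n (c (n + 1)).force (c (n + 1 + 1)).force :=
      fun n => hc (n + 1) n n.lt_succ_self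
    obtain ⟨x, hx⟩ := X.complete (fun n => (c (n + 1)).force) hc'
    refine ⟨⟨x⟩, fun n m hm => ?_⟩
    obtain ⟨k, rfl⟩ : ∃ k, n = k + 1 := ⟨n - 1, by omega⟩
    exact X.trans (hx m)
      (X.chain_dist (c := fun n => (c (n + 1)).force) hc' (Nat.lt_succ_iff.mp hm))

/-- `Next : X → ▶ X`. -/
def next {X : Cofe.{u}} : Hom X (later X) :=
  ⟨Later.next, fun {_ _ _} h _ hm => X.dist_mono hm.le h⟩

/-- The action `▶ f : ▶ X → ▶ Y` of the later modality on maps. -/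
def laterMap {X Y : Cofe.{u}} (f : Hom X Y) : Hom (later X) (later Y) :=
  ⟨fun x => Later.next (f x.force), fun h m hm => f.ne (h m hm)⟩

theorem laterMap_dist {X Y : Cofe.{u}} {n : ℕ} {f g : Hom X Y}
    (h : ∀ m < n, (fn X Y).dist m f g) (x : later X) :
    (later Y).dist n (laterMap f x) (laterMap g x) := fun m hm => h m hm x.force

theorem exists_fix (X : Cofe.{u}) (x₀ : X) (f : Hom (later X) X) : ∃ x, f (next x) = x := by
  let c : ℕ → X := fun n => (fun x => f (next x))^[n] x₀
  have hs : ∀ n, c (n + 1) = f (next (c n)) := fun n => Function.iterate_succ_apply' _ _ _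
  have hc : ∀ n, X.dist n (c (n + 1)) (c (n + 1 + 1)) := by
    intro n
    induction n using Nat.strong_induction_on with
    | _ n ih =>
      rw [hs, hs (n + 1)]
      refine f.ne fun m hm => ?_
      have h1 : X.dist m (c (m + 1)) (c n) :=
        by
          have hch : ∀ j, m ≤ j → j < n → X.dist m (c (m + 1)) (c (j + 1)) := by
            intro j hj hjn
            induction j, hj using Nat.le_induction with
            | base => exact X.refl _ _
            | succ j hj ihj =>
              exact X.trans (ihj (by omega)) (X.dist_mono hj (ih j (by omega)))
          obtain ⟨k, rfl⟩ : ∃ k, n = k + 1 := ⟨n - 1, by omega⟩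
          exact hch k (by omega) (by omega)
      have h2 : X.dist m (c (m + 1)) (c (n + 1)) := by
        obtain ⟨k, rfl⟩ : ∃ k, n = k + 1 := ⟨n - 1, by omega⟩
        have h3 := X.dist_mono (Nat.lt_succ_iff.mp hm) (ih k (Nat.lt_succ_self k))
        exact X.trans h1 h3
      exact X.trans (X.symm h1) h2
  obtain ⟨x, hx⟩ := X.complete (fun n => c (n + 1)) hc
  refine ⟨x, X.eq_of_dist fun n => ?_⟩
  have h1 : X.dist n (f (next x)) (c (n + 1 + 1)) := by
    rw [hs (n + 1)]
    exact f.ne fun m hm => X.dist_mono hm.le (hx n)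
  exact X.trans h1 (X.trans (X.symm (hc n)) (X.symm (hx n)))

/-- The guarded fixed point combinator `(▶ X → X) → X`.  The element `x₀` only witnesses
that `X` is inhabited. -/
noncomputable def fix {X : Cofe.{u}} (x₀ : X) (f : Hom (later X) X) : X :=
  Classical.choose (exists_fix X x₀ f)

theorem fix_eq {X : Cofe.{u}} (x₀ : X) (f : Hom (later X) X) : f (next (fix x₀ f)) = fix x₀ f :=
  Classical.choose_spec (exists_fix X x₀ f)

theorem fix_dist {X : Cofe.{u}} (x₀ : X) {f g : Hom (later X) X} {n : ℕ}
    (h : (fn (later X) X).dist n f g) : X.dist n (fix x₀ f) (fix x₀ g) := by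
  induction n using Nat.strong_induction_on with
  | _ n ih =>
    rw [← fix_eq x₀ f, ← fix_eq x₀ g]
    exact X.trans (h _) (g.ne fun m hm => ih m hm ((fn (later X) X).dist_mono hm.le h))

end Cofe

open Cofe

/-! ## Guarded recursive types -/

/-- Locally contractive functors, contravariant in the first and covariant in the second argument:
type expressions `F(X)` in which every occurrence of `X` is guarded by `▶`, negative and positive
occurrences being kept apart. -/
structure GFunctor : Type (u + 1) where
  obj : Cofe.{u} → Cofe.{u} → Cofe.{u}
  map : ∀ {X X' Y Y' : Cofe.{u}}, Hom X' X → Hom Y Y' → Hom (obj X Y) (obj X' Y')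
  map_id : ∀ {X Y : Cofe.{u}} (z : obj X Y), map (Hom.id X) (Hom.id Y) z = z
  map_comp : ∀ {X X' X'' Y Y' Y'' : Cofe.{u}} (f : Hom X' X) (f' : Hom X'' X')
    (g : Hom Y Y') (g' : Hom Y' Y'') (z : obj X Y),
    map (f.comp f') (g'.comp g) z = map f' g' (map f g z)
  map_contractive : ∀ {X X' Y Y' : Cofe.{u}} {n : ℕ} {f f' : Hom X' X} {g g' : Hom Y Y'},
    (∀ m < n, (fn X' X).dist m f f') → (∀ m < n, (fn Y Y').dist m g g') → ∀ z : obj X Y,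
    (obj X' Y').dist n (map f g z) (map f' g' z)

namespace GFunctor

/-- The constant functor. -/
def const (A : Cofe.{u}) : GFunctor.{u} where
  obj _ _ := A
  map _ _ := Hom.id A
  map_id _ := rfl
  map_comp _ _ _ _ _ := rfl
  map_contractive _ _ _ := A.refl _ _

/-- The functor `▶ X`. -/
def later : GFunctor.{u} where
  obj _ Y := Cofe.later Y
  map _ g := laterMap g
  map_id _ := rfl
  map_comp _ _ _ _ _ := rfl
  map_contractive _ hg z := laterMap_dist hg z

/-- The functor `▶ (X → X)`. -/
def laterEndo : GFunctor.{u} where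
  obj X Y := Cofe.later (fn X Y)
  map f g := laterMap ⟨fun h => g.comp (h.comp f), fun h x => g.ne (h (f x))⟩
  map_id _ := rfl
  map_comp _ _ _ _ _ := rfl
  map_contractive {_ _ _ Y' _ _ _ _ _} hf hg z m hm x :=
    Y'.trans (hg m hm _) (Hom.ne _ (z.force.ne (hf m hm x)))

/-- Products `F(X) × G(X)`. -/
def prod (F G : GFunctor.{u}) : GFunctor.{u} where
  obj X Y := Cofe.prod (F.obj X Y) (G.obj X Y)
  map f g := ⟨fun z => (F.map f g z.1, G.map f g z.2), fun h => ⟨Hom.ne _ h.1, Hom.ne _ h.2⟩⟩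
  map_id z := Prod.ext (F.map_id z.1) (G.map_id z.2)
  map_comp f f' g g' z := Prod.ext (F.map_comp f f' g g' z.1) (G.map_comp f f' g g' z.2)
  map_contractive hf hg z := ⟨F.map_contractive hf hg z.1, G.map_contractive hf hg z.2⟩

/-- Function types `F(X) → G(X)`. -/
def arrow (F G : GFunctor.{u}) : GFunctor.{u} where
  obj X Y := fn (F.obj Y X) (G.obj X Y)
  map f g := ⟨fun h => (G.map f g).comp (h.comp (F.map g f)), fun h x => Hom.ne _ (h _)⟩
  map_id z := by
    refine Hom.ext (funext fun x => ?_)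
    exact (G.map_id _).trans (congrArg z.toFun (F.map_id x))
  map_comp f f' g g' z := by
    refine Hom.ext (funext fun x => ?_)
    refine (G.map_comp f f' g g' _).trans ?_
    exact congrArg (fun y => G.map f' g' (G.map f g (z.toFun y))) (F.map_comp g' g f' f x)
  map_contractive {X X' Y Y' n f f' g g'} hf hg z x :=
    (G.obj X' Y').trans (G.map_contractive hf hg _)
      (Hom.ne _ (z.ne (F.map_contractive hg hf x)))

/-- Disjoint unions `Σ i, F i (X)`. -/
def sigma (I : Type u) (F : I → GFunctor.{u}) : GFunctor.{u} where
  obj X Y := Cofe.sigma I fun i => (F i).obj X Y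
  map f g := ⟨fun z => ⟨z.1, (F z.1).map f g z.2⟩, by
    rintro n ⟨i, x⟩ ⟨j, y⟩ ⟨h, hxy⟩
    cases h
    exact ⟨rfl, Hom.ne _ hxy⟩⟩
  map_id z := Sigma.ext rfl (heq_of_eq ((F z.1).map_id z.2))
  map_comp f f' g g' z := Sigma.ext rfl (heq_of_eq ((F z.1).map_comp f f' g g' z.2))
  map_contractive hf hg z := ⟨rfl, (F z.1).map_contractive hf hg z.2⟩

section Solution

/-! The solution of `X ≅ F(X)` is the limit of the approximations `1, F(1), F(F(1)), …`. -/

variable (F : GFunctor.{u}) (z₀ : F.obj (discrete PUnit) (discrete PUnit))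

/-- The approximations of the solution. -/
def approx : ℕ → Cofe.{u}
  | 0 => discrete PUnit
  | k + 1 => F.obj (approx k) (approx k)

/-- The canonical maps between the approximations: projections downwards, embeddings upwards. -/
def coerce : ∀ k j : ℕ, Hom (F.approx k) (F.approx j)
  | _, 0 => Hom.const _ PUnit.unit
  | 0, j + 1 => (F.map (coerce j 0) (coerce 0 j)).comp (Hom.const (discrete PUnit) z₀)
  | k + 1, j + 1 => F.map (coerce j k) (coerce k j)
termination_by k j => k + j

theorem coerce_zero (k : ℕ) : F.coerce z₀ k 0 = Hom.const _ PUnit.unit := by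
  cases k <;> rw [coerce]

theorem coerce_zero_succ (j : ℕ) : F.coerce z₀ 0 (j + 1) =
    (F.map (F.coerce z₀ j 0) (F.coerce z₀ 0 j)).comp (Hom.const (discrete PUnit) z₀) := by
  conv_lhs => rw [coerce]
  rfl

theorem coerce_succ (k j : ℕ) : F.coerce z₀ (k + 1) (j + 1) =
    F.map (F.coerce z₀ j k) (F.coerce z₀ k j) := by
  rw [coerce]

theorem coerce_self (k : ℕ) : F.coerce z₀ k k = Hom.id _ := by
  induction k with
  | zero => rw [coerce_zero]; rfl
  | succ k ih => rw [coerce_succ, ih]; exact Hom.ext (funext fun z => F.map_id z)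

theorem coerce_comp (m : ℕ) : ∀ k j : ℕ, min k j ≤ m →
    (F.coerce z₀ m j).comp (F.coerce z₀ k m) = F.coerce z₀ k j := by
  induction m with
  | zero =>
    intro k j h
    rcases Nat.eq_zero_or_pos j with rfl | hj
    · rw [coerce_zero, coerce_zero]; rfl
    · obtain rfl : k = 0 := by omega
      rw [coerce_self]; rfl
  | succ m ih =>
    intro k j h
    cases j with
    | zero => rw [coerce_zero, coerce_zero]; rfl
    | succ j =>
      cases k with
      | zero =>
        rw [coerce_succ, coerce_zero_succ, coerce_zero_succ, ← ih j 0 (by omega),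
          ← ih 0 j (by omega)]
        exact Hom.ext (funext fun z => (F.map_comp _ _ _ _ _).symm)
      | succ k =>
        rw [coerce_succ, coerce_succ, coerce_succ, ← ih j k (by omega), ← ih k j (by omega)]
        exact Hom.ext (funext fun z => (F.map_comp _ _ _ _ _).symm)

theorem coerce_retract (j : ℕ) : ∀ (k n : ℕ), n < j → j ≤ k → ∀ x,
    (F.approx k).dist n (F.coerce z₀ j k (F.coerce z₀ k j x)) x := by
  induction j with
  | zero => intro k n h; omega
  | succ j ih =>
    intro k n hn hk x
    obtain ⟨k, rfl⟩ : ∃ i, k = i + 1 := ⟨k - 1, by omega⟩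
    rw [coerce_succ, coerce_succ]
    refine Cofe.trans _ (Cofe.of_eq _ (F.map_comp _ _ _ _ _).symm) ?_
    have h := F.map_contractive (n := n)
      (f := (F.coerce z₀ j k).comp (F.coerce z₀ k j)) (f' := Hom.id _)
      (g := (F.coerce z₀ j k).comp (F.coerce z₀ k j)) (g' := Hom.id _)
      (fun m hm y => ih k m (by omega) (by omega) y)
      (fun m hm y => ih k m (by omega) (by omega) y) x
    exact Cofe.trans _ h (Cofe.of_eq _ (F.map_id _))

/-- Coherent families of elements of the approximations. -/
@[ext] structure Tower : Type u where
  val : ∀ k, F.approx k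
  coh : ∀ j k, j ≤ k → F.coerce z₀ k j (val k) = val j

/-- The guarded recursive type `X` with `X ≅ F(X)`. -/
def mu : Cofe.{u} where
  Carrier := Tower F z₀
  dist n x y := ∀ k, (F.approx k).dist n (x.val k) (y.val k)
  dist_equiv n := ⟨fun x k => Cofe.refl _ n (x.val k), fun h k => Cofe.symm _ (h k),
    fun h h' k => Cofe.trans _ (h k) (h' k)⟩
  dist_mono h hxy k := Cofe.dist_mono _ h (hxy k)
  eq_of_dist h := Tower.ext (funext fun k => Cofe.eq_of_dist _ fun n => h n k)
  complete c hc := by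
    choose l hl using fun k => (F.approx k).complete (fun n => (c n).val k) (fun n => hc n k)
    refine ⟨⟨l, fun j k h => Cofe.eq_of_dist _ fun n => ?_⟩, fun n k => hl k n⟩
    refine Cofe.trans _ (Hom.ne _ (hl k n)) ?_
    rw [(c n).coh j k h]
    exact Cofe.symm _ (hl j n)

/-- Projection to an approximation. -/
def proj (k : ℕ) : Hom (F.mu z₀) (F.approx k) := ⟨fun x => x.val k, fun h => h k⟩

/-- Embedding of an approximation. -/
def embed (k : ℕ) : Hom (F.approx k) (F.mu z₀) :=
  ⟨fun x => ⟨fun j => F.coerce z₀ k j x, fun i j h =>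
    congrArg (fun f => f.toFun x) (F.coerce_comp z₀ j k i (by omega))⟩,
    fun h j => (F.coerce z₀ k j).ne h⟩

theorem embed_comp_coerce {j k : ℕ} (h : j ≤ k) :
    (F.embed z₀ k).comp (F.coerce z₀ j k) = F.embed z₀ j :=
  Hom.ext (funext fun x => Tower.ext (funext fun i =>
    congrArg (fun f => f.toFun x) (F.coerce_comp z₀ k j i (by omega))))

theorem coerce_comp_proj {j k : ℕ} (h : j ≤ k) :
    (F.coerce z₀ k j).comp (F.proj z₀ k) = F.proj z₀ j :=
  Hom.ext (funext fun x => x.coh j k h)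

theorem coerce_proj_dist {k n : ℕ} (h : n < k) (j : ℕ) (x : F.mu z₀) :
    (F.approx j).dist n (F.coerce z₀ k j (x.val k)) (x.val j) := by
  rcases le_total j k with hjk | hjk
  · exact Cofe.of_eq _ (x.coh j k hjk)
  · rw [← x.coh k j hjk]
    exact F.coerce_retract z₀ k j n h hjk _

/-- The map `F(X) → X`. -/
def fold : Hom (F.obj (F.mu z₀) (F.mu z₀)) (F.mu z₀) where
  toFun z := {
    val := fun k => match k with
      | 0 => PUnit.unit
      | k + 1 => F.map (F.embed z₀ k) (F.proj z₀ k) z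
    coh := by
      intro j k h
      cases j with
      | zero => rw [coerce_zero]; rfl
      | succ j =>
        obtain ⟨k, rfl⟩ : ∃ i, k = i + 1 := ⟨k - 1, by omega⟩
        dsimp only
        rw [coerce_succ, ← F.map_comp, embed_comp_coerce F z₀ (by omega),
          coerce_comp_proj F z₀ (by omega)] }
  ne h k := match k with
    | 0 => rfl
    | _ + 1 => Hom.ne _ h

theorem unfold_chain (x : F.mu z₀) (n : ℕ) : (F.obj (F.mu z₀) (F.mu z₀)).dist n
    (F.map (F.proj z₀ n) (F.embed z₀ n) (x.val (n + 1)))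
    (F.map (F.proj z₀ (n + 1)) (F.embed z₀ (n + 1)) (x.val (n + 1 + 1))) := by
  rw [← x.coh (n + 1) (n + 1 + 1) (by omega), coerce_succ]
  refine Cofe.trans _ (Cofe.of_eq _ (F.map_comp _ _ _ _ _).symm) ?_
  refine F.map_contractive (fun m hm y => ?_) (fun m hm y => ?_) _
  · exact F.coerce_proj_dist z₀ hm (n + 1) y
  · intro i
    refine Cofe.trans _ (Cofe.of_eq _ ?_) (Hom.ne (F.coerce z₀ (n + 1) i)
      (F.coerce_retract z₀ n (n + 1) m hm (by omega) y))
    exact congrArg (fun f => f.toFun (F.coerce z₀ (n + 1) n y))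
      (F.coerce_comp z₀ (n + 1) n i (by omega)).symm

/-- The map `X → F(X)`. -/
noncomputable def unfold : Hom (F.mu z₀) (F.obj (F.mu z₀) (F.mu z₀)) where
  toFun x := Classical.choose (Cofe.complete _ _ (F.unfold_chain z₀ x))
  ne {n x y} h := by
    have hx := Classical.choose_spec (Cofe.complete _ _ (F.unfold_chain z₀ x)) n
    have hy := Classical.choose_spec (Cofe.complete _ _ (F.unfold_chain z₀ y)) n
    exact Cofe.trans _ hx (Cofe.trans _ (Hom.ne _ (h (n + 1))) (Cofe.symm _ hy))

theorem unfold_dist (x : F.mu z₀) (n : ℕ) : (F.obj (F.mu z₀) (F.mu z₀)).dist n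
    (F.unfold z₀ x) (F.map (F.proj z₀ n) (F.embed z₀ n) (x.val (n + 1))) :=
  Classical.choose_spec (Cofe.complete _ _ (F.unfold_chain z₀ x)) n

theorem unfold_fold (z : F.obj (F.mu z₀) (F.mu z₀)) : F.unfold z₀ (F.fold z₀ z) = z := by
  refine Cofe.eq_of_dist _ fun n => Cofe.trans _ (F.unfold_dist z₀ _ n) ?_
  change (F.obj (F.mu z₀) (F.mu z₀)).dist n (F.map (F.proj z₀ n) (F.embed z₀ n)
    (F.map (F.embed z₀ n) (F.proj z₀ n) z)) z
  rw [← F.map_comp]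
  have h := F.map_contractive (n := n)
    (f := (F.embed z₀ n).comp (F.proj z₀ n)) (f' := Hom.id _)
    (g := (F.embed z₀ n).comp (F.proj z₀ n)) (g' := Hom.id _)
    (fun m hm y j => F.coerce_proj_dist z₀ hm j y)
    (fun m hm y j => F.coerce_proj_dist z₀ hm j y) z
  rw [F.map_id] at h
  exact h

theorem fold_unfold (x : F.mu z₀) : F.fold z₀ (F.unfold z₀ x) = x := by
  refine Tower.ext (funext fun k => ?_)
  cases k with
  | zero => rfl
  | succ k =>
    refine Cofe.eq_of_dist _ fun n => ?_
    have h := Cofe.dist_mono _ (le_max_left n k) (F.unfold_dist z₀ x (max n k))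
    refine Cofe.trans _ (Hom.ne (F.map (F.embed z₀ k) (F.proj z₀ k)) h) (Cofe.of_eq _ ?_)
    refine (F.map_comp _ _ _ _ _).symm.trans ?_
    have e : F.map (F.coerce z₀ k (max n k)) (F.coerce z₀ (max n k) k)
        (x.val (max n k + 1)) = x.val (k + 1) := by
      rw [← coerce_succ]
      exact x.coh _ _ (by omega)
    exact e

end Solution

end GFunctor

/-! ## Guarded interaction trees -/

/-- Effect signatures: a set of names of operations, with their input and output arities. -/
structure Signature : Type (u + 1) where
  Op : Type u
  Ins : Op → GFunctor.{u}
  Outs : Op → GFunctor.{u}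

/-- A ground type containing a unit value, and a set of errors containing the runtime error. -/
structure Base : Type (u + 1) where
  Ground : Cofe.{u}
  unit : Ground
  Error : Type u
  runTime : Error

/-- The constructors of guarded interaction trees. -/
inductive Shape (E : Signature.{u}) : Type u
  | ret
  | fn
  | err
  | tau
  | vis (i : E.Op)

/-- The arguments of the constructors: `Ret : A`, `Fun : ▶ (X → X)`, `Err : Error`, `Tau : ▶ X` and
`Vis i : Ins i X × (Outs i X → ▶ X)`. -/
def argF (E : Signature.{u}) (B : Base.{u}) : Shape E → GFunctor.{u}
  | .ret => GFunctor.const B.Ground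
  | .fn => GFunctor.laterEndo
  | .err => GFunctor.const (discrete B.Error)
  | .tau => GFunctor.later
  | .vis i => (E.Ins i).prod ((E.Outs i).arrow GFunctor.later)

/-- The functor whose fixed point is the type of guarded interaction trees. -/
def treeF (E : Signature.{u}) (B : Base.{u}) : GFunctor.{u} := GFunctor.sigma (Shape E) (argF E B)

/-- The base point of the approximations. -/
def treeF₀ (E : Signature.{u}) (B : Base.{u}) :
    (treeF E B).obj (discrete PUnit) (discrete PUnit) := ⟨.err, B.runTime⟩

/-- The guarded type of guarded interaction trees. -/
def IT (E : Signature.{u}) (B : Base.{u}) : Cofe.{u} := (treeF E B).mu (treeF₀ E B)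

section Trees

variable {E : Signature.{u}} {B : Base.{u}}

/-- Construction of a tree from a constructor and its arguments. -/
def roll : Hom ((treeF E B).obj (IT E B) (IT E B)) (IT E B) := (treeF E B).fold (treeF₀ E B)

/-- The constructor of a tree and its arguments. -/
noncomputable def unroll : Hom (IT E B) ((treeF E B).obj (IT E B) (IT E B)) :=
  (treeF E B).unfold (treeF₀ E B)

theorem unroll_roll (z : (treeF E B).obj (IT E B) (IT E B)) : unroll (roll z) = z :=
  GFunctor.unfold_fold _ _ z

theorem roll_unroll (α : IT E B) : roll (unroll α) = α := GFunctor.fold_unfold _ _ α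

/-- Leaves of ground type. -/
def Ret : Hom B.Ground (IT E B) := ⟨fun a => roll ⟨.ret, a⟩, fun h => roll.ne ⟨rfl, h⟩⟩

/-- Function leaves. -/
def Fun : Hom (later (fn (IT E B) (IT E B))) (IT E B) :=
  ⟨fun g => roll ⟨.fn, g⟩, fun h => roll.ne ⟨rfl, h⟩⟩

/-- Errors. -/
def Err (e : B.Error) : IT E B := roll ⟨.err, e⟩

/-- Silent steps. -/
def Tau : Hom (later (IT E B)) (IT E B) := ⟨fun t => roll ⟨.tau, t⟩, fun h => roll.ne ⟨rfl, h⟩⟩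

/-- `Tick α = Tau (Next α)`. -/
def Tick (α : IT E B) : IT E B := Tau (next α)

/-- Effects: the input is `x` and the continuation is `k`. -/
def Vis (i : E.Op) (x : (E.Ins i).obj (IT E B) (IT E B))
    (k : Hom ((E.Outs i).obj (IT E B) (IT E B)) (later (IT E B))) : IT E B :=
  roll ⟨.vis i, (x, k)⟩

theorem Vis_dist {i : E.Op} {n : ℕ} {x y : (E.Ins i).obj (IT E B) (IT E B)}
    {k l : Hom ((E.Outs i).obj (IT E B) (IT E B)) (later (IT E B))}
    (hx : ((E.Ins i).obj (IT E B) (IT E B)).dist n x y)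
    (hk : (Cofe.fn ((E.Outs i).obj (IT E B) (IT E B)) (later (IT E B))).dist n k l) :
    (IT E B).dist n (Vis i x k) (Vis i y l) := roll.ne ⟨rfl, hx, hk⟩

/-- One unfolding of `extend r f`, where `s` is the recursive call. -/
noncomputable def extendBody (r : Hom B.Ground (IT E B))
    (f : Hom (later (fn (IT E B) (IT E B))) (IT E B)) (s : later (fn (IT E B) (IT E B))) :
    (treeF E B).obj (IT E B) (IT E B) → IT E B
  | ⟨.ret, a⟩ => r a
  | ⟨.fn, g⟩ => f g
  | ⟨.err, e⟩ => Err e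
  | ⟨.tau, t⟩ => Tau (laterMap s.force t)
  | ⟨.vis i, z⟩ => Vis i z.1 ((laterMap s.force).comp z.2)

theorem extendBody_dist {n : ℕ} {r r' : Hom B.Ground (IT E B)}
    {f f' : Hom (later (fn (IT E B) (IT E B))) (IT E B)} {s s' : later (fn (IT E B) (IT E B))}
    {z z' : (treeF E B).obj (IT E B) (IT E B)}
    (hr : (Cofe.fn B.Ground (IT E B)).dist n r r')
    (hf : (Cofe.fn (later (fn (IT E B) (IT E B))) (IT E B)).dist n f f')
    (hs : (later (fn (IT E B) (IT E B))).dist n s s')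
    (hz : ((treeF E B).obj (IT E B) (IT E B)).dist n z z') :
    (IT E B).dist n (extendBody r f s z) (extendBody r' f' s' z') := by
  obtain ⟨i, z⟩ := z
  obtain ⟨j, z'⟩ := z'
  obtain ⟨h, hz⟩ := hz
  cases h
  have hl : ∀ t t' : later (IT E B), (later (IT E B)).dist n t t' →
      (later (IT E B)).dist n (laterMap s.force t) (laterMap s'.force t') := fun t t' ht =>
    (later (IT E B)).trans ((laterMap s.force).ne ht) (laterMap_dist hs t')
  cases i with
  | ret => exact (IT E B).trans (r.ne hz) (hr z')
  | fn => exact (IT E B).trans (f.ne hz) (hf z')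
  | err => exact roll.ne ⟨rfl, hz⟩
  | tau => exact Tau.ne (hl z z' hz)
  | vis i => exact Vis_dist hz.1 fun y => hl _ _ (hz.2 y)

/-- The functional of which `extend r f` is the fixed point. -/
noncomputable def extendStep (r : Hom B.Ground (IT E B))
    (f : Hom (later (fn (IT E B) (IT E B))) (IT E B)) :
    Hom (later (fn (IT E B) (IT E B))) (fn (IT E B) (IT E B)) where
  toFun s := ⟨fun α => extendBody r f s (unroll α), fun {n _ _} h =>
    extendBody_dist (Cofe.refl (Cofe.fn _ _) n r) (Cofe.refl (Cofe.fn _ _) n f)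
      (Cofe.refl _ n s) (unroll.ne h)⟩
  ne {n _ _} h α := extendBody_dist (Cofe.refl (Cofe.fn _ _) n r)
    (Cofe.refl (Cofe.fn _ _) n f) h (Cofe.refl _ n (unroll α))

/-- The guarded recursive function on trees that is `r` on `Ret`, `f` on `Fun`, and commutes with
`Err`, `Tau` and `Vis`. -/
noncomputable def extend (r : Hom B.Ground (IT E B))
    (f : Hom (later (fn (IT E B) (IT E B))) (IT E B)) : Hom (IT E B) (IT E B) :=
  fix (X := Cofe.fn (IT E B) (IT E B)) (Hom.const _ (Err B.runTime)) (extendStep r f)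

theorem extend_dist {n : ℕ} {r r' : Hom B.Ground (IT E B)}
    {f f' : Hom (later (fn (IT E B) (IT E B))) (IT E B)}
    (hr : (Cofe.fn B.Ground (IT E B)).dist n r r')
    (hf : (Cofe.fn (later (fn (IT E B) (IT E B))) (IT E B)).dist n f f') :
    (Cofe.fn (IT E B) (IT E B)).dist n (extend r f) (extend r' f') :=
  fix_dist (X := Cofe.fn (IT E B) (IT E B)) _ (f := extendStep r f) (g := extendStep r' f')
    fun s α => extendBody_dist hr hf (Cofe.refl _ n s) (Cofe.refl _ n (unroll α))

theorem extend_eq (r : Hom B.Ground (IT E B)) (f : Hom (later (fn (IT E B) (IT E B))) (IT E B))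
    (α : IT E B) : extend r f α =
      extendBody r f (next (X := Cofe.fn (IT E B) (IT E B)) (extend r f)) (unroll α) :=
  (congrArg (fun g : Hom (IT E B) (IT E B) => g α)
    (fix_eq (X := Cofe.fn (IT E B) (IT E B)) (Hom.const _ (Err B.runTime)) (extendStep r f))).symm

theorem extend_ret (r : Hom B.Ground (IT E B)) (f : Hom (later (fn (IT E B) (IT E B))) (IT E B))
    (a : B.Ground) : extend r f (Ret a) = r a :=
  (extend_eq r f _).trans (congrArg (extendBody r f _) (unroll_roll ⟨.ret, a⟩))

theorem extend_fun (r : Hom B.Ground (IT E B)) (f : Hom (later (fn (IT E B) (IT E B))) (IT E B))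
    (g : later (fn (IT E B) (IT E B))) : extend r f (Fun g) = f g :=
  (extend_eq r f _).trans (congrArg (extendBody r f _) (unroll_roll ⟨.fn, g⟩))

theorem extend_err (r : Hom B.Ground (IT E B)) (f : Hom (later (fn (IT E B) (IT E B))) (IT E B))
    (e : B.Error) : extend r f (Err e) = Err e :=
  (extend_eq r f _).trans (congrArg (extendBody r f _) (unroll_roll ⟨.err, e⟩))

theorem extend_tau (r : Hom B.Ground (IT E B)) (f : Hom (later (fn (IT E B) (IT E B))) (IT E B))
    (t : later (IT E B)) : extend r f (Tau t) = Tau (laterMap (extend r f) t) :=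
  (extend_eq r f _).trans (congrArg (extendBody r f _) (unroll_roll ⟨.tau, t⟩))

theorem extend_vis (r : Hom B.Ground (IT E B)) (f : Hom (later (fn (IT E B) (IT E B))) (IT E B))
    (i : E.Op) (x : (E.Ins i).obj (IT E B) (IT E B))
    (k : Hom ((E.Outs i).obj (IT E B) (IT E B)) (later (IT E B))) :
    extend r f (Vis i x k) = Vis i x ((laterMap (extend r f)).comp k) :=
  (extend_eq r f _).trans (congrArg (extendBody r f _) (unroll_roll ⟨.vis i, (x, k)⟩))

/-- `getval f α` evaluates `α` to a value and applies `f` to that value. -/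
noncomputable def getval (f : Hom (IT E B) (IT E B)) : Hom (IT E B) (IT E B) :=
  extend (f.comp Ret) (f.comp Fun)

theorem getval_dist {n : ℕ} {f f' : Hom (IT E B) (IT E B)}
    (h : (Cofe.fn (IT E B) (IT E B)).dist n f f') :
    (Cofe.fn (IT E B) (IT E B)).dist n (getval f) (getval f') :=
  extend_dist (fun a => h (Ret a)) (fun g => h (Fun g))

/-- `getfun f α` evaluates `α` to a function and applies `f` to it; a runtime error results
if the value of `α` is not a function. -/
noncomputable def getfun (f : Hom (later (fn (IT E B) (IT E B))) (IT E B)) :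
    Hom (IT E B) (IT E B) :=
  extend (Hom.const _ (Err B.runTime)) f

theorem getfun_dist {n : ℕ} {f f' : Hom (later (fn (IT E B) (IT E B))) (IT E B)}
    (h : (Cofe.fn (later (fn (IT E B) (IT E B))) (IT E B)).dist n f f') :
    (Cofe.fn (IT E B) (IT E B)).dist n (getfun f) (getfun f') :=
  extend_dist (Cofe.refl _ n _) h

/-- `callLater v g = Tau (▶ (fun g => g v) g)`. -/
def callLater (v : IT E B) : Hom (later (fn (IT E B) (IT E B))) (IT E B) :=
  Tau.comp (laterMap (X := Cofe.fn (IT E B) (IT E B))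
    ⟨fun g : Hom (IT E B) (IT E B) => g v, fun h => h v⟩)

theorem callLater_dist {n : ℕ} {v v' : IT E B} (h : (IT E B).dist n v v') :
    (Cofe.fn (later (fn (IT E B) (IT E B))) (IT E B)).dist n (callLater v) (callLater v') :=
  fun g => Tau.ne fun _ hm => Hom.ne (X := IT E B) g.force ((IT E B).dist_mono hm.le h)

/-- Application of (the value of) `α` to the value `v`. -/
noncomputable def appVal (α : IT E B) : Hom (IT E B) (IT E B) :=
  ⟨fun v => getfun (callLater v) α, fun h => getfun_dist (callLater_dist h) α⟩

/-- Call-by-value application: the argument is evaluated before the function. -/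
noncomputable def app (α β : IT E B) : IT E B := getval (appVal α) β

theorem app_dist {n : ℕ} {α α' β β' : IT E B} (hα : (IT E B).dist n α α')
    (hβ : (IT E B).dist n β β') : (IT E B).dist n (app α β) (app α' β') :=
  (IT E B).trans ((getval (appVal α)).ne hβ)
    (getval_dist (f := appVal α) (f' := appVal α') (fun v => (getfun (callLater v)).ne hα) β')

end Trees

/-! ## Context-dependent reification and reduction -/

/-- Context-dependent reifiers: a type of states and, for every operation, a partial function of
the input, the state and the current continuation. -/
structure Reifier (E : Signature.{u}) (B : Base.{u}) : Type (u + 1) where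
  State : Type u
  run : ∀ i : E.Op, (E.Ins i).obj (IT E B) (IT E B) → State →
    Hom ((E.Outs i).obj (IT E B) (IT E B)) (later (IT E B)) → Option (later (IT E B) × State)

section Reduction

variable {E : Signature.{u}} {B : Base.{u}} (R : Reifier E B)

/-- Reification of the top-level effect of a tree. -/
noncomputable def reify (p : IT E B × R.State) : IT E B × R.State :=
  match unroll p.1 with
  | ⟨.vis i, z⟩ =>
    match R.run i z.1 p.2 z.2 with
    | some (β, σ') => (Tau β, σ')
    | none => (Err B.runTime, p.2)
  | _ => p

/-- The reduction relation `(α, σ) ⇝ (β, σ')`. -/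
def IStep (p q : IT E B × R.State) : Prop :=
  (p.1 = Tick q.1 ∧ p.2 = q.2) ∨
    ∃ i x k, p.1 = Vis i x k ∧ reify R p = (Tick q.1, q.2)

end Reduction

/-! ## The lambda calculus with exceptions -/

/-- Expressions, with de Bruijn indices for variables.  In `recE e`, the recursive function
`rec f x = e`, index `0` of the body is `x` and index `1` is `f`.  In `tryCatch c e₁ e₂`,
that is `try e₁ catch c h with e₂`, index `0` of `e₂` is `h`. -/
inductive Expr (Exc : Type u) : Type u
  | recE (e : Expr Exc)
  | var (i : ℕ)
  | app (e₁ e₂ : Expr Exc)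
  | tryCatch (c : Exc) (e₁ e₂ : Expr Exc)
  | raise (c : Exc) (e : Expr Exc)

/-- Values: recursive functions. -/
structure Val (Exc : Type u) : Type u where
  body : Expr Exc

/-- Values as expressions. -/
def Val.toExpr {Exc : Type u} (v : Val Exc) : Expr Exc := .recE v.body

namespace Expr

variable {Exc : Type u}

/-- Lifting of a renaming under a binder. -/
def upRen (r : ℕ → ℕ) : ℕ → ℕ
  | 0 => 0
  | i + 1 => r i + 1

/-- Renaming of variables. -/
def rename : (ℕ → ℕ) → Expr Exc → Expr Exc
  | r, .recE e => .recE (rename (upRen (upRen r)) e)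
  | r, .var i => .var (r i)
  | r, .app e₁ e₂ => .app (rename r e₁) (rename r e₂)
  | r, .tryCatch c e₁ e₂ => .tryCatch c (rename r e₁) (rename (upRen r) e₂)
  | r, .raise c e => .raise c (rename r e)

/-- Lifting of a substitution under a binder. -/
def up (s : ℕ → Expr Exc) : ℕ → Expr Exc
  | 0 => .var 0
  | i + 1 => rename Nat.succ (s i)

/-- Simultaneous capture-avoiding substitution. -/
def subst : (ℕ → Expr Exc) → Expr Exc → Expr Exc
  | s, .recE e => .recE (subst (up (up s)) e)
  | s, .var i => s i
  | s, .app e₁ e₂ => .app (subst s e₁) (subst s e₂)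
  | s, .tryCatch c e₁ e₂ => .tryCatch c (subst s e₁) (subst (up s) e₂)
  | s, .raise c e => .raise c (subst s e)

/-- The substitution of `e` for index `0` that lowers the other indices by one. -/
def inst (e : Expr Exc) : ℕ → Expr Exc
  | 0 => e
  | i + 1 => .var i

/-- The substitution of `e` for index `0` and `e'` for index `1` that lowers the other indices
by two. -/
def inst₂ (e e' : Expr Exc) : ℕ → Expr Exc
  | 0 => e
  | 1 => e'
  | i + 2 => .var i

end Expr

/-- The layers of evaluation contexts. -/
inductive Frame (Exc : Type u) : Type u
  /-- `□ v` -/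
  | appL (v : Val Exc)
  /-- `e □` -/
  | appR (e : Expr Exc)
  /-- `try □ catch c h with e` -/
  | catchF (c : Exc) (e : Expr Exc)
  /-- `throw c □` -/
  | raiseF (c : Exc)

/-- Evaluation contexts, as the stack of their layers with the innermost layer first: `F :: K`
is `K[F]`, the empty stack is `□`, and `K ++ K'` is `K'[K]`. -/
abbrev Ectx (Exc : Type u) : Type u := List (Frame Exc)

/-- Configurations of the abstract machine. -/
inductive Cfg (Exc : Type u) : Type u
  | eval (e : Expr Exc) (K : Ectx Exc)
  | cont (K : Ectx Exc) (v : Val Exc)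
  | term (e : Expr Exc)
  | ret (v : Val Exc)

/-- The transitions of the abstract machine. -/
inductive Step {Exc : Type u} : Cfg Exc → Cfg Exc → Prop
  | term (e) : Step (.term e) (.eval e [])
  | ret (v) : Step (.cont [] v) (.ret v)
  | app (e₀ e₁ K) : Step (.eval (.app e₀ e₁) K) (.eval e₁ (.appR e₀ :: K))
  | val (v : Val Exc) (K) : Step (.eval v.toExpr K) (.cont K v)
  | appR (e v K) : Step (.cont (.appR e :: K) v) (.eval e (.appL v :: K))
  | appL (w v : Val Exc) (K) :
      Step (.cont (.appL w :: K) v) (.eval w.toExpr (.appR v.toExpr :: K))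
  | beta (e) (v : Val Exc) (K) :
      Step (.cont (.appR (.recE e) :: K) v) (.eval (e.subst (Expr.inst₂ v.toExpr (.recE e))) K)
  | tryCatch (c e₁ e₂ K) : Step (.eval (.tryCatch c e₁ e₂) K) (.eval e₁ (.catchF c e₂ :: K))
  | raise (c e K) : Step (.eval (.raise c e) K) (.eval e (.raiseF c :: K))
  | pop (c e) (v : Val Exc) (K) : Step (.cont (.catchF c e :: K) v) (.eval v.toExpr K)
  | catch (c e) (v : Val Exc) (K K') (h : ∀ e', Frame.catchF c e' ∉ K) :
      Step (.cont (.raiseF c :: (K ++ .catchF c e :: K')) v)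
        (.eval (e.subst (Expr.inst v.toExpr)) K')

/-! ## Exceptions as effects -/

/-- The operations of the effect signature. -/
inductive ExcOp : Type u
  | throw
  | register
  | pop

/-- The effect signature of exceptions. -/
def excSig (Exc : Type u) : Signature.{u} where
  Op := ExcOp.{u}
  Ins
    | .throw => (GFunctor.const (discrete Exc)).prod GFunctor.later
    | .register => (GFunctor.const (discrete Exc)).prod
        ((GFunctor.later.arrow GFunctor.later).prod GFunctor.later)
    | .pop => GFunctor.const (discrete Exc)
  Outs
    | .throw => GFunctor.const (discrete PEmpty)
    | .register => GFunctor.later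
    | .pop => GFunctor.const (discrete PUnit)

section Exceptions

variable {Exc : Type u} {B : Base.{u}}

/-- Handler stacks: lists of an exception name, a handler and a saved continuation, the
innermost handler first. -/
abbrev ExcState (Exc : Type u) (B : Base.{u}) : Type u :=
  List (Exc × Hom (later (IT (excSig Exc) B)) (later (IT (excSig Exc) B)) ×
    Hom (later (IT (excSig Exc) B)) (later (IT (excSig Exc) B)))

/-- The reifier of `register` pushes the handler and the current continuation. -/
def runRegister (z : ((excSig Exc).Ins .register).obj (IT (excSig Exc) B) (IT (excSig Exc) B))
    (σ : ExcState Exc B) (κ : Hom (later (IT (excSig Exc) B)) (later (IT (excSig Exc) B))) :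
    Option (later (IT (excSig Exc) B) × ExcState Exc B) :=
  some (z.2.2, (z.1, z.2.1, κ) :: σ)

/-- The reifier of `throw` calls the first handler for the exception with the payload and passes
the result to the saved continuation. -/
def runThrow [DecidableEq Exc] (c : Exc) (x : later (IT (excSig Exc) B)) :
    ExcState Exc B → Option (later (IT (excSig Exc) B) × ExcState Exc B)
  | [] => none
  | (c', h, κ') :: σ => if c = c' then some (κ' (h x), σ) else runThrow c x σ

/-- The reifier of `pop` removes the topmost handler, which has to be one for the exception, and
passes the output to the current continuation and then to the saved one. -/
def runPop [DecidableEq Exc] (c : Exc) (σ : ExcState Exc B)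
    (κ : Hom (discrete PUnit) (later (IT (excSig Exc) B))) :
    Option (later (IT (excSig Exc) B) × ExcState Exc B) :=
  match σ with
  | [] => none
  | (c', _, κ') :: σ' => if c = c' then some (κ' (κ PUnit.unit), σ') else none

/-- The reifiers of exceptions. -/
def excReifier (Exc : Type u) [DecidableEq Exc] (B : Base.{u}) : Reifier (excSig Exc) B where
  State := ExcState Exc B
  run
    | .throw, z, σ, _ => runThrow z.1 z.2 σ
    | .register, z, σ, κ => runRegister z σ κ
    | .pop, c, σ, κ => runPop c σ κ

/-- `POP c = Vis pop c (fun _ => Next (Ret ()))`. -/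
def POP (c : Exc) : IT (excSig Exc) B :=
  Vis (E := excSig Exc) ExcOp.pop c (Hom.const _ (next (X := IT (excSig Exc) B) (Ret B.unit)))

/-- `REG c h x = Vis register (c, h, x) id`. -/
def REG (c : Exc) (h : Hom (later (IT (excSig Exc) B)) (later (IT (excSig Exc) B)))
    (x : later (IT (excSig Exc) B)) : IT (excSig Exc) B :=
  Vis (E := excSig Exc) ExcOp.register (c, h, x) (Hom.id _)

/-- The map `fun r => Vis throw (c, Next r) elim`, with `elim` the map out of the empty type. -/
def throwVal (c : Exc) : Hom (IT (excSig Exc) B) (IT (excSig Exc) B) :=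
  ⟨fun r => Vis (E := excSig Exc) ExcOp.throw (c, next (X := IT (excSig Exc) B) r)
    ⟨fun y => PEmpty.elim y, fun {_ y _} _ => PEmpty.elim y⟩,
    fun h => Vis_dist ⟨rfl, next.ne h⟩ fun y => PEmpty.elim y⟩

/-- `THROW c x = getval (x, fun r => Vis throw (c, Next r) elim)`. -/
noncomputable def THROW (c : Exc) : Hom (IT (excSig Exc) B) (IT (excSig Exc) B) :=
  getval (throwVal c)

/-- The map `fun r => getval (POP c, fun _ => r)`. -/
noncomputable def popVal (c : Exc) : Hom (IT (excSig Exc) B) (IT (excSig Exc) B) :=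
  ⟨fun r => getval (Hom.const _ r) (POP c), fun h => getval_dist (fun _ => h) (POP c)⟩

/-- `CATCH c h x = REG c h (Next (getval (x, fun r => getval (POP c, fun _ => r))))`. -/
noncomputable def CATCH (c : Exc)
    (h : Hom (later (IT (excSig Exc) B)) (later (IT (excSig Exc) B)))
    (x : IT (excSig Exc) B) : IT (excSig Exc) B :=
  REG c h (next (getval (popVal c) x))

theorem CATCH_dist (c : Exc) {n : ℕ}
    {h h' : Hom (later (IT (excSig Exc) B)) (later (IT (excSig Exc) B))}
    {x x' : IT (excSig Exc) B}
    (hh : (Cofe.fn (later (IT (excSig Exc) B)) (later (IT (excSig Exc) B))).dist n h h')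
    (hx : (IT (excSig Exc) B).dist n x x') :
    (IT (excSig Exc) B).dist n (CATCH c h x) (CATCH c h' x') :=
  Vis_dist ⟨rfl, hh, next.ne ((getval (popVal c)).ne hx)⟩ (Cofe.refl _ n _)

/-! ## Denotational semantics -/

/-- Environments. -/
abbrev Env (Exc : Type u) (B : Base.{u}) : Cofe.{u} := power ℕ (IT (excSig Exc) B)

/-- The environment with value `α` for index `0`, and `ρ i` for index `i + 1`. -/
def push (α : IT (excSig Exc) B) (ρ : Env Exc B) : Env Exc B
  | 0 => α
  | i + 1 => ρ i

theorem push_dist {n : ℕ} {α α' : IT (excSig Exc) B} {ρ ρ' : Env Exc B}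
    (hα : (IT (excSig Exc) B).dist n α α') (hρ : (Env Exc B).dist n ρ ρ') :
    (Env Exc B).dist n (push α ρ) (push α' ρ') := fun i =>
  match i with
  | 0 => hα
  | i + 1 => hρ i

/-- The map `fun α => d (ρ[0 ↦ α])`. -/
def lam (d : Hom (Env Exc B) (IT (excSig Exc) B)) (ρ : Env Exc B) :
    Hom (IT (excSig Exc) B) (IT (excSig Exc) B) :=
  ⟨fun α => d (push α ρ), fun {n _ _} h => d.ne (push_dist h ((Env Exc B).refl n ρ))⟩

theorem lam_dist (d : Hom (Env Exc B) (IT (excSig Exc) B)) {n : ℕ} {ρ ρ' : Env Exc B}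
    (h : (Env Exc B).dist n ρ ρ') :
    (Cofe.fn (IT (excSig Exc) B) (IT (excSig Exc) B)).dist n (lam d ρ) (lam d ρ') :=
  fun α => d.ne (push_dist ((IT (excSig Exc) B).refl n α) h)

/-- The map `fun t => Fun (▶ (fun φ => fun α => d (ρ[x ↦ α, f ↦ φ])) t)`. -/
def recBody (d : Hom (Env Exc B) (IT (excSig Exc) B)) (ρ : Env Exc B) :
    Hom (later (IT (excSig Exc) B)) (IT (excSig Exc) B) :=
  Fun.comp (laterMap (Y := Cofe.fn _ _)
    ⟨fun φ => lam d (push φ ρ), fun {n _ _} h => lam_dist d (push_dist h ((Env Exc B).refl n ρ))⟩)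

theorem recBody_dist (d : Hom (Env Exc B) (IT (excSig Exc) B)) {n : ℕ} {ρ ρ' : Env Exc B}
    (h : (Env Exc B).dist n ρ ρ') :
    (Cofe.fn (later (IT (excSig Exc) B)) (IT (excSig Exc) B)).dist n
      (recBody d ρ) (recBody d ρ') := fun _ =>
  Fun.ne fun _ hm => lam_dist d
    (push_dist (Cofe.refl _ _ _) ((Env Exc B).dist_mono hm.le h))

/-- The denotation of expressions. -/
noncomputable def denotE : Expr Exc → Hom (Env Exc B) (IT (excSig Exc) B)
  | .recE e => ⟨fun ρ => fix (Err B.runTime) (recBody (denotE e) ρ),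
      fun h => fix_dist _ (recBody_dist (denotE e) h)⟩
  | .var i => ⟨fun ρ => ρ i, fun h => h i⟩
  | .app e₁ e₂ => ⟨fun ρ => app (denotE e₁ ρ) (denotE e₂ ρ),
      fun h => app_dist ((denotE e₁).ne h) ((denotE e₂).ne h)⟩
  | .tryCatch c e₁ e₂ => ⟨fun ρ => CATCH c (laterMap (lam (denotE e₂) ρ)) (denotE e₁ ρ),
      fun h => CATCH_dist c
        (laterMap_dist fun _ hm => (Cofe.fn _ _).dist_mono hm.le (lam_dist (denotE e₂) h))
        ((denotE e₁).ne h)⟩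
  | .raise c e => (THROW c).comp (denotE e)

/-- The denotation of evaluation contexts: the continuation up to the innermost handler, and
the stack of handlers. -/
noncomputable def denotK (ρ : Env Exc B) :
    Ectx Exc → Hom (IT (excSig Exc) B) (IT (excSig Exc) B) × ExcState Exc B
  | [] => (Hom.id _, [])
  | .appL v :: K =>
    ((denotK ρ K).1.comp ⟨fun x => app x (denotE v.toExpr ρ),
      fun {n _ _} h => app_dist h (Cofe.refl _ n _)⟩, (denotK ρ K).2)
  | .appR e :: K =>
    ((denotK ρ K).1.comp ⟨fun x => app (denotE e ρ) x,
      fun {n _ _} h => app_dist (Cofe.refl _ n _) h⟩, (denotK ρ K).2)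
  | .raiseF c :: K => ((denotK ρ K).1.comp (THROW c), (denotK ρ K).2)
  | .catchF c e :: K =>
    (getval (popVal c),
      (c, laterMap (lam (denotE e) ρ), laterMap (denotK ρ K).1) :: (denotK ρ K).2)

/-- The denotation of configurations. -/
noncomputable def denotCfg (ρ : Env Exc B) : Cfg Exc → IT (excSig Exc) B × ExcState Exc B
  | .eval e K => ((denotK ρ K).1 (denotE e ρ), (denotK ρ K).2)
  | .cont K v => ((denotK ρ K).1 (denotE v.toExpr ρ), (denotK ρ K).2)
  | .term e => (denotE e ρ, [])
  | .ret v => (denotE v.toExpr ρ, [])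

end Exceptions

end GITree

/-! The machine transitions fall into two kinds. Those that only move the focus (starting,
returning, entering an application or a `throw`, passing from a value to its context, and the two
swaps between the sides of an application) regroup the same composite `κ(⟦e⟧)` and leave the handler
stack alone; both sides have definitionally equal denotations, so zero reductions suffice. Each of
the other four, namely beta, entering `try`, leaving `try` with a value, and catching, is matched by
exactly one reduction.

In those four cases the redex denotes a `Tick` or a `Vis`. When a continuation `κ` surrounds it,
that constructor has to be brought to the top. This is the role of `isHomomorphism_denotK`: the
continuation of every context commutes with `Tau` and `Vis`. Moving `κ` through `Vis` also composes
`▶κ` with the continuation of the effect, which is how the reifier of `register` comes to save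
precisely the `▶κ` that the denotation of the `try` frame puts on the stack.

Three further facts complete the argument. Values denote `Fun` leaves (`exists_denotE_val`), so
`getval` applies its function to them at once. Substitution is a change of environment
(`denotE_subst`), which identifies the results of beta and of a handler call. The stack denoted by a
context lists its handlers innermost first, so the search made by `throw` skips a segment without
handler for the exception (`runThrow_denotK`). -/

namespace GITree

open Cofe

/-! ### Maps commuting with `Tau` and `Vis`, and single reduction steps -/

section Homomorphisms

variable {E : Signature.{u}} {B : Base.{u}}

/-- Maps of trees that commute with `Tau` and `Vis`. -/
structure IsHomomorphism (κ : Hom (IT E B) (IT E B)) : Prop where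
  map_tau : ∀ t, κ (Tau t) = Tau (laterMap κ t)
  map_vis : ∀ (i : E.Op) (x : (E.Ins i).obj (IT E B) (IT E B))
    (k : Hom ((E.Outs i).obj (IT E B) (IT E B)) (later (IT E B))),
    κ (Vis i x k) = Vis i x ((laterMap κ).comp k)

namespace IsHomomorphism

theorem id : IsHomomorphism (Hom.id (IT E B)) := ⟨fun _ => rfl, fun _ _ _ => rfl⟩

theorem comp {κ κ' : Hom (IT E B) (IT E B)} (h : IsHomomorphism κ) (h' : IsHomomorphism κ') :
    IsHomomorphism (κ.comp κ') where
  map_tau t := (congrArg κ.toFun (h'.map_tau t)).trans (h.map_tau _)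
  map_vis i x k := (congrArg κ.toFun (h'.map_vis i x k)).trans (h.map_vis i x _)

/-- Both `getval` and `getfun` are instances of `extend`, so this covers every basic map from which
context continuations are composed. -/
theorem extend (r : Hom B.Ground (IT E B)) (f : Hom (later (fn (IT E B) (IT E B))) (IT E B)) :
    IsHomomorphism (extend r f) := ⟨extend_tau r f, extend_vis r f⟩

theorem map_tick {κ : Hom (IT E B) (IT E B)} (h : IsHomomorphism κ) (α : IT E B) :
    κ (Tick α) = Tick (κ α) := h.map_tau _

end IsHomomorphism

theorem getval_ret (f : Hom (IT E B) (IT E B)) (a : B.Ground) : getval f (Ret a) = f (Ret a) :=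
  extend_ret _ _ a

theorem getval_fun (f : Hom (IT E B) (IT E B)) (g : later (fn (IT E B) (IT E B))) :
    getval f (Fun g) = f (Fun g) := extend_fun _ _ g

theorem app_fun (α : IT E B) (g : later (fn (IT E B) (IT E B))) :
    app α (Fun g) = getfun (callLater (Fun g)) α := getval_fun (appVal α) g

/-- Application evaluates its argument first, so it is recursive in the function position only once
the argument is a value: then the outer `getval` disappears and a `getfun` remains. The map `κ` is
specified pointwise because the frame `□ v` mentions `⟦v⟧`, which equals a `Fun` leaf only
propositionally. -/
theorem isHomomorphism_app_fun (g : later (fn (IT E B) (IT E B))) {κ : Hom (IT E B) (IT E B)}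
    (h : ∀ α, κ α = app α (Fun g)) : IsHomomorphism κ := by
  have e : κ = getfun (callLater (Fun g)) := Hom.ext (funext fun α => (h α).trans (app_fun α g))
  rw [e]
  exact IsHomomorphism.extend _ _

/-- The function sits under `▶`, and the `Tau` of `callLater` pays for opening it; this is the one
`Tick` of a beta step. -/
theorem app_fun_next (f : Hom (IT E B) (IT E B)) (g : later (fn (IT E B) (IT E B))) :
    app (Fun (Later.next f)) (Fun g) = Tick (f (Fun g)) :=
  (app_fun _ g).trans (extend_fun _ _ _)

theorem reify_vis_some (R : Reifier E B) {i : E.Op} {x : (E.Ins i).obj (IT E B) (IT E B)}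
    {k : Hom ((E.Outs i).obj (IT E B) (IT E B)) (later (IT E B))} {σ σ' : R.State}
    {β : later (IT E B)} (h : R.run i x σ k = some (β, σ')) :
    reify R (Vis i x k, σ) = (Tau β, σ') := by
  have hu : unroll (Vis i x k) = ⟨.vis i, (x, k)⟩ := unroll_roll _
  unfold reify
  simp only [hu]
  rw [h]

/-- The `Vis` form of `α` is taken as an equation, since the denotation of a configuration acquires
this form only after its continuation has been moved inside the effect. -/
theorem IStep.of_run {R : Reifier E B} {i : E.Op} {x : (E.Ins i).obj (IT E B) (IT E B)}
    {k : Hom ((E.Outs i).obj (IT E B) (IT E B)) (later (IT E B))} {α β : IT E B}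
    {σ σ' : R.State} (hα : α = Vis i x k) (h : R.run i x σ k = some (next β, σ')) :
    IStep R (α, σ) (β, σ') :=
  Or.inr ⟨i, x, k, hα, by rw [hα]; exact reify_vis_some R h⟩

end Homomorphisms

/-! ### Renaming and substitution as change of environment -/

section Substitution

variable {Exc : Type u} {B : Base.{u}}

theorem lam_congr {d d' : Hom (Env Exc B) (IT (excSig Exc) B)} {ρ ρ' : Env Exc B}
    (h : ∀ α, d (push α ρ) = d' (push α ρ')) : lam d ρ = lam d' ρ' :=
  Hom.ext (funext h)

/-- Reduces equality of two recursive functions to equality of their bodies: once the functionals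
agree, so do their fixed points, and no guarded induction is needed. The denotation and the
environment vary together, because substitution changes the first and is compensated in the second.
-/
theorem recBody_congr {d d' : Hom (Env Exc B) (IT (excSig Exc) B)} {ρ ρ' : Env Exc B}
    (h : ∀ α φ, d (push α (push φ ρ)) = d' (push α (push φ ρ'))) :
    recBody d ρ = recBody d' ρ' :=
  Hom.ext (funext fun t => congrArg (fun g => Fun.toFun (Later.next g))
    (lam_congr fun α => h α t.force))

theorem push_upRen (r : ℕ → ℕ) (α : IT (excSig Exc) B) (ρ : Env Exc B) :
    (fun i => push α ρ (Expr.upRen r i)) = push α (fun i => ρ (r i)) :=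
  funext fun i => by cases i <;> rfl

/-- Needed before substitution, because lifting a substitution under a binder renames its terms. The
renaming and the environment stay universally quantified in the induction, as both change at a
binder. -/
theorem denotE_rename (e : Expr Exc) : ∀ (r : ℕ → ℕ) (ρ : Env Exc B),
    denotE (e.rename r) ρ = denotE e (fun i => ρ (r i)) := by
  induction e with
  | recE e ih =>
    intro r ρ
    refine congrArg (fix (Err B.runTime)) (recBody_congr fun α φ => ?_)
    rw [ih, push_upRen, push_upRen]
  | var i => intro r ρ; rfl
  | app e₁ e₂ ih₁ ih₂ => intro r ρ; exact congrArg₂ app (ih₁ r ρ) (ih₂ r ρ)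
  | tryCatch c e₁ e₂ ih₁ ih₂ =>
    intro r ρ
    refine congrArg₂ (fun f x => CATCH c (laterMap f) x) (lam_congr fun α => ?_) (ih₁ r ρ)
    rw [ih₂, push_upRen]
  | raise c e ih => intro r ρ; exact congrArg (THROW c).toFun (ih r ρ)

theorem denotE_up (s : ℕ → Expr Exc) (α : IT (excSig Exc) B) (ρ : Env Exc B) :
    (fun i => denotE (Expr.up s i) (push α ρ)) = push α (fun i => denotE (s i) ρ) :=
  funext fun i => by
    cases i with
    | zero => rfl
    -- Composing `push α ρ` with the successor gives back `ρ` by definition.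
    | succ i => exact denotE_rename (s i) _ _

theorem denotE_subst (e : Expr Exc) : ∀ (s : ℕ → Expr Exc) (ρ : Env Exc B),
    denotE (e.subst s) ρ = denotE e (fun i => denotE (s i) ρ) := by
  induction e with
  | recE e ih =>
    intro s ρ
    refine congrArg (fix (Err B.runTime)) (recBody_congr fun α φ => ?_)
    rw [ih, denotE_up, denotE_up]
  | var i => intro s ρ; rfl
  | app e₁ e₂ ih₁ ih₂ => intro s ρ; exact congrArg₂ app (ih₁ s ρ) (ih₂ s ρ)
  | tryCatch c e₁ e₂ ih₁ ih₂ =>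
    intro s ρ
    refine congrArg₂ (fun f x => CATCH c (laterMap f) x) (lam_congr fun α => ?_) (ih₁ s ρ)
    rw [ih₂, denotE_up]
  | raise c e ih => intro s ρ; exact congrArg (THROW c).toFun (ih s ρ)

theorem denotE_inst (e e' : Expr Exc) (ρ : Env Exc B) :
    denotE (e.subst (Expr.inst e')) ρ = denotE e (push (denotE e' ρ) ρ) := by
  rw [denotE_subst]
  exact congrArg (denotE e).toFun (funext fun i => by cases i <;> rfl)

theorem denotE_inst₂ (e e' e'' : Expr Exc) (ρ : Env Exc B) :
    denotE (e.subst (Expr.inst₂ e' e'')) ρ =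
      denotE e (push (denotE e' ρ) (push (denotE e'' ρ) ρ)) := by
  rw [denotE_subst]
  exact congrArg (denotE e).toFun (funext fun i => by rcases i with _ | _ | i <;> rfl)

end Substitution

/-! ### Denotations of values and contexts, and the four proper transitions -/

section Machine

variable {Exc : Type u} {B : Base.{u}}

/-- One unfolding of the guarded fixed point. The recursion is hidden under the `▶` of `Fun`, so the
unfolding costs no `Tick` and exhibits a value. -/
theorem denotE_recE (e : Expr Exc) (ρ : Env Exc B) :
    denotE (.recE e) ρ = Fun (Later.next (lam (denotE e) (push (denotE (.recE e) ρ) ρ))) :=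
  (fix_eq (Err B.runTime) (recBody (denotE e) ρ)).symm

theorem exists_denotE_val (v : Val Exc) (ρ : Env Exc B) : ∃ g, denotE v.toExpr ρ = Fun g :=
  ⟨_, denotE_recE v.body ρ⟩

theorem getval_val (f : Hom (IT (excSig Exc) B) (IT (excSig Exc) B)) (v : Val Exc)
    (ρ : Env Exc B) : getval f (denotE v.toExpr ρ) = f (denotE v.toExpr ρ) := by
  obtain ⟨g, hg⟩ := exists_denotE_val v ρ
  rw [hg, getval_fun]

/-- Each frame contributes a `getval` or `getfun` in its hole, and homomorphisms compose. For `□ v`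
it matters that evaluation contexts allow only values on the right. -/
theorem isHomomorphism_denotK (ρ : Env Exc B) (K : Ectx Exc) :
    IsHomomorphism (denotK ρ K).1 := by
  induction K with
  | nil => exact IsHomomorphism.id
  | cons F K ih =>
    cases F with
    | appL v =>
      obtain ⟨g, hg⟩ := exists_denotE_val v ρ
      exact ih.comp (isHomomorphism_app_fun g fun α => congrArg (app α) hg)
    | appR e => exact ih.comp (IsHomomorphism.extend (E := excSig Exc) _ _)
    -- No induction hypothesis: the continuation of the outer context is stored in the handler
    -- stack, and the current one starts afresh at the handler.
    | catchF c e => exact IsHomomorphism.extend _ _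
    | raiseF c => exact ih.comp (IsHomomorphism.extend _ _)

theorem denotE_beta (e : Expr Exc) (v : Val Exc) (ρ : Env Exc B) :
    app (denotE (.recE e) ρ) (denotE v.toExpr ρ) =
      Tick (denotE (e.subst (Expr.inst₂ v.toExpr (.recE e))) ρ) := by
  obtain ⟨g, hg⟩ := exists_denotE_val v ρ
  -- Unfolding the recursive function also affects its occurrence in the environment on the right;
  -- the last rewrite folds that occurrence back.
  rw [denotE_inst₂, denotE_recE e ρ, hg, app_fun_next, ← denotE_recE e ρ]
  rfl

/-- Only `try` frames add entries to the stack, and by `hK` those of `K` carry other names, so the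
search passes over them. What `K` does to the payload is irrelevant: the continuation resumed is the
one saved when the handler for `c` was installed. -/
theorem runThrow_denotK [DecidableEq Exc] (ρ : Env Exc B) (c : Exc) (e : Expr Exc)
    (K K' : Ectx Exc) (hK : ∀ e', Frame.catchF c e' ∉ K) (x : later (IT (excSig Exc) B)) :
    runThrow c x (denotK ρ (K ++ .catchF c e :: K')).2 =
      some (laterMap (denotK ρ K').1 (laterMap (lam (denotE e) ρ) x), (denotK ρ K').2) := by
  induction K with
  | nil => exact if_pos rfl
  | cons F K ih =>
    have ih := ih fun e' h => hK e' (List.mem_cons_of_mem _ h)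
    cases F with
    | catchF c' e' =>
      have hc : c ≠ c' := by
        rintro rfl
        exact hK e' List.mem_cons_self
      exact (if_neg hc).trans ih
    | _ => exact ih

variable [DecidableEq Exc]

theorem istep_beta (ρ : Env Exc B) (e : Expr Exc) (v : Val Exc) (K : Ectx Exc) :
    IStep (excReifier Exc B) (denotCfg ρ (.cont (.appR (.recE e) :: K) v))
      (denotCfg ρ (.eval (e.subst (Expr.inst₂ v.toExpr (.recE e))) K)) :=
  Or.inl ⟨(congrArg (denotK ρ K).1.toFun (denotE_beta e v ρ)).trans
    ((isHomomorphism_denotK ρ K).map_tick _), rfl⟩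

/-- `REG` has the identity as its continuation, so after `κ` has moved inside, the reifier sees `▶κ`
itself and the resulting state is definitionally the one denoted by the extended context. -/
theorem istep_tryCatch (ρ : Env Exc B) (c : Exc) (e₁ e₂ : Expr Exc) (K : Ectx Exc) :
    IStep (excReifier Exc B) (denotCfg ρ (.eval (.tryCatch c e₁ e₂) K))
      (denotCfg ρ (.eval e₁ (.catchF c e₂ :: K))) :=
  IStep.of_run ((isHomomorphism_denotK ρ K).map_vis ExcOp.register _ _) rfl

theorem istep_pop (ρ : Env Exc B) (c : Exc) (e : Expr Exc) (v : Val Exc) (K : Ectx Exc) :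
    IStep (excReifier Exc B) (denotCfg ρ (.cont (.catchF c e :: K) v))
      (denotCfg ρ (.eval v.toExpr K)) := by
  -- On a value, the continuation of the `try` frame becomes the effect `POP c` followed by
  -- returning that value. The topmost entry of the stack belongs to this very frame, so the name
  -- test succeeds.
  refine IStep.of_run ((getval_val (popVal c) v ρ).trans
    (extend_vis (E := excSig Exc) _ _ ExcOp.pop c _)) ((if_pos rfl).trans ?_)
  -- The current continuation turns the unit output of `POP` into `v`, and the saved one is that of
  -- `K`.
  exact congrArg (fun α => some (next ((denotK ρ K).1 α), (denotK ρ K).2))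
    (getval_ret (Hom.const _ (denotE v.toExpr ρ)) B.unit)

theorem istep_catch (ρ : Env Exc B) (c : Exc) (e : Expr Exc) (v : Val Exc) (K K' : Ectx Exc)
    (hK : ∀ e', Frame.catchF c e' ∉ K) :
    IStep (excReifier Exc B) (denotCfg ρ (.cont (.raiseF c :: (K ++ .catchF c e :: K')) v))
      (denotCfg ρ (.eval (e.subst (Expr.inst v.toExpr)) K')) := by
  -- The payload is a value, so `THROW` is a `Vis` immediately. The continuation gathered while
  -- moving it outwards is discarded by the reifier of `throw`.
  refine IStep.of_run ((congrArg (denotK ρ (K ++ .catchF c e :: K')).1.toFun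
    (getval_val (throwVal c) v ρ)).trans
    ((isHomomorphism_denotK ρ _).map_vis ExcOp.throw _ _))
    ((runThrow_denotK ρ c e K K' hK _).trans ?_)
  rw [denotE_inst]
  rfl

end Machine

end GITree

/-- Soundness of the denotational semantics of the lambda calculus with exceptions: a transition of
the abstract machine is matched by zero or more reductions of guarded interaction trees. -/
theorem mainTheorem3 {Exc : Type u} [DecidableEq Exc] (B : GITree.Base.{u})
    (c₀ c₁ : GITree.Cfg Exc) (h : GITree.Step c₀ c₁) (ρ : GITree.Env Exc B) :
    Relation.ReflTransGen (GITree.IStep (GITree.excReifier Exc B))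
      (GITree.denotCfg ρ c₀) (GITree.denotCfg ρ c₁) := by
  cases h with
  | beta e v K => exact .single (GITree.istep_beta ρ e v K)
  | tryCatch c e₁ e₂ K => exact .single (GITree.istep_tryCatch ρ c e₁ e₂ K)
  | pop c e v K => exact .single (GITree.istep_pop ρ c e v K)
  -- The administrative transitions close by reflexivity, both denotations being definitionally
  -- equal; only catching falls through to the second alternative, where `‹_›` finds the hypothesis
  -- that `K` has no handler for the exception.
  | _ => first
    | exact .refl
    | exact .single (GITree.istep_catch ρ _ _ _ _ _ ‹_›)
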